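/- Let $\mathbb H$ be the real quaternions. For $M\in\mathbb H^{m\times m}$ and indices $i,j$, the row and column determinants are $$\operatorname{rdet}_i M=\sum_{\sigma\in S_m}(-1)^{m-p}\,C_1C_2\cdots C_p,\qquad \operatorname{cdet}_j M=\sum_{\sigma\in S_m}(-1)^{m-p}\,C_p\cdots C_2C_1 ,$$ where $p$ is the number of cycles of $\sigma$ (fixed points included). The product of the $t$-th cycle is $C_t=m_{c\,\sigma(c)}\,m_{\sigma(c)\,\sigma^2(c)}\cdots m_{\sigma^{-1}(c)\,c}$, where $c=c_t$ is its opening element. The first cycle is the one containing $i$ (respectively $j$) and is opened by that index. The other cycles are opened by their least elements, and $c_2<c_3<\dots<c_p$. If $M$ is Hermitian, all row and column determinants of $M$ have the same real value, denoted $\det M$ (with $\det M=1$ for the empty matrix). The rank of a quaternion matrix is the maximal number of right-linearly independent columns. The index of $A\in\mathbb H^{n\times n}$ is the least $k\ge 0$ with $\operatorname{rank}A^{k+1}=\operatorname{rank}A^{k}$. The Drazin inverse $A^D$ of a matrix $A$ of index $k$ is the unique $X$ with $A^{k+1}X=A^k$, $XAX=X$ and $AX=XA$. For $\beta\subseteq\{1,\dots,n\}$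 let $M_\beta^\beta$ be the principal submatrix of $M$ with rows and columns in $\beta$. Its rows and columns keep the labels they have in $M$. Let $M_{.i}(b)$ (respectively $M_{j.}(b)$) be $M$ with its $i$-th column (respectively $j$-th row) replaced by $b$. Let $a^{(k)}_{.j}$ and $a^{(k)}_{i.}$ be the $j$-th column and the $i$-th row of $A^k$. **Theorem.** Let $A\in\mathbb H^{n\times n}$ be Hermitian of index $k$ with $\operatorname{rank}A^{k+1}=\operatorname{rank}A^k=r$. Then $A$ has a unique Drazin inverse $A^D=(a^D_{ij})$, the real number $d=\sum_{|\beta|=r}\det\,(A^{k+1})_\beta^\beta$ is nonzero, and for all $i,j\in\{1,\dots,n\}$ $$a^D_{ij}=\frac1d\sum_{|\beta|=r,\ i\in\beta}\operatorname{cdet}_i\Big(\big((A^{k+1})_{.i}(a^{(k)}_{.j})\big)_\beta^\beta\Big)=\frac1d\sum_{|\alpha|=r,\ j\in\alpha}\operatorname{rdet}_j\Big(\big((A^{k+1})_{j.}(a^{(k)}_{i.})\big)_\alpha^\alpha\Big).$$ -/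

import Mathlib

open scoped Quaternion

noncomputable section

namespace QuatDrazin

section RowColumnDeterminants

variable {ι R : Type*} [Fintype ι] [LinearOrder ι] [Ring R]

/-- The ordered product `a_{c, σ c} a_{σ c, σ² c} ⋯ a_{σ^{l} c, c}` of the entries of `A` along the
cycle `(c, σ c, …, σ^l c)` of `σ` through `c`, where `l + 1` is the length of that cycle
(a fixed point `c` contributes the single factor `a_{c, c}`). -/
def cycleProd (A : Matrix ι ι R) (σ : Equiv.Perm ι) (c : ι) : R :=
  ((List.range (Function.minimalPeriod σ c)).map
    fun m => A ((σ ^ m) c) ((σ ^ (m + 1)) c)).prod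

/-- The opening elements of the cycles of `σ` (fixed points included), in order, when the cycle of
`i` comes first and is opened by `i`: the list starts with `i`, and then come the least elements of
all the other cycles, in increasing order. -/
def cycleHeads (σ : Equiv.Perm ι) (i : ι) : List ι :=
  i :: (Finset.univ.filter
    fun c => ¬ σ.SameCycle i c ∧ ∀ d, σ.SameCycle c d → c ≤ d).sort

/-- The `i`-th row determinant. The cycle of `i` gives the leftmost block of each summand, and the
other cycles follow from left to right. The sign of a permutation of `n` letters with `r` cycles
(fixed points included) is `(-1)^(n - r)`. -/
def rdet (i : ι) (A : Matrix ι ι R) : R :=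
  ∑ σ : Equiv.Perm ι,
    ((Equiv.Perm.sign σ : ℤ) : R) * ((cycleHeads σ i).map (cycleProd A σ)).prod

/-- The `j`-th column determinant. The cycle of `j` gives the rightmost block of each summand, and
the other cycles follow from right to left. Inside a cycle, written from right to left as
`(c_l ⋯ c_1 c)` with `c_1 = τ⁻¹ c`, `c_2 = τ⁻² c`, …, the factors are
`a_{c, c_l} ⋯ a_{c_2, c_1} a_{c_1, c}`, which is `cycleProd A τ c`. -/
def cdet (j : ι) (A : Matrix ι ι R) : R :=
  ∑ τ : Equiv.Perm ι,
    ((Equiv.Perm.sign τ : ℤ) : R) * ((cycleHeads τ j).reverse.map (cycleProd A τ)).prod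

/-- The determinant of a Hermitian quaternion matrix is the common value of all of its row and
column determinants. It is read off here from the row determinant at the least index, and it is `1`
for the empty matrix. -/
def hdet (A : Matrix ι ι R) : R :=
  if h : (Finset.univ : Finset ι).Nonempty then rdet (Finset.univ.min' h) A else 1

end RowColumnDeterminants

section Submatrices

variable {ι R : Type*}

/-- The principal submatrix with rows and columns indexed by `β` (in the order inherited
from `ι`). -/
def principal (A : Matrix ι ι R) (β : Finset ι) : Matrix β β R :=
  A.submatrix Subtype.val Subtype.val

end Submatrices

section Drazin

variable {n : ℕ}

/-- The rank of a quaternion matrix: the maximal number of right-linearly independent columns,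
that is, the dimension of the right vector space (a module over `ℍᵐᵒᵖ`) spanned by the columns. -/
def qrank (A : Matrix (Fin n) (Fin n) ℍ[ℝ]) : ℕ :=
  Module.finrank ℍ[ℝ]ᵐᵒᵖ (Submodule.span ℍ[ℝ]ᵐᵒᵖ (Set.range fun j : Fin n => A.col j))

/-- The index of a square quaternion matrix: the least `k ≥ 0` with
`rank A ^ (k + 1) = rank A ^ k`. -/
def index (A : Matrix (Fin n) (Fin n) ℍ[ℝ]) : ℕ :=
  sInf {k : ℕ | qrank (A ^ (k + 1)) = qrank (A ^ k)}

/-- `X` is a Drazin inverse of `A`. -/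
structure IsDrazinInverse (A X : Matrix (Fin n) (Fin n) ℍ[ℝ]) : Prop where
  pow_mul : A ^ (index A + 1) * X = A ^ index A
  mul_mul : X * A * X = X
  comm : A * X = X * A

end Drazin

end QuatDrazin

end

/-!
The proof is the Faddeev–LeVerrier version of Cramer's rule, carried out with column determinants.

*Cofactors.* In the column determinant at `i` of the principal submatrix on `T`, with column `i`
replaced by `b`, the vector `b` enters linearly, with left coefficients `cofactor M T i l`. Splitting
a permutation by its first step `i ↦ y`, that is, writing it as `swap i y * τ` with `τ i = i`,
expands the determinant over `T` into determinants over `T \ {i}` (`colExp_eq`). If `M` is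
Hermitian, then removing also the last step shows, by induction on `T`, that the principal minors are
real and that the cofactors form a Hermitian matrix with a first-step and a last-step recursion
(`cofactorRules`). Real numbers are central, so the order of the cycles no longer matters.

*Cramer's rule.* The matrix `N` of cofactors satisfies `N * M = diag h`, where `h i` is the
determinant expanded at `i` (`sum_cofactor_mul`). The expansions agree: `M * N * M` is both
`diag h * M` and `M * diag h`, so `h i * M i c = M i c * h c`. This settles the case `M i c ≠ 0`, and
the case `M i c = 0` follows by perturbing that entry and passing to the limit.

*Sums of minors.* Let `d s` be the sum of the principal minors of `M` of order `s`, and `C s` the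
matrix of the sums of the cofactors over the index sets of cardinality `s`. The last-step recursion
and Cramer's rule give `C (s + 1) = d s - C s * M` (`adjCoeff_succ`). Let `s` be the largest order
with `d s ≠ 0`. The recursion ends at `0`, so a power of `M` times `C (s + 1)` vanishes, and then
`C (s + 1) * M = 0` since `M` is Hermitian. Hence `(d s)⁻¹ * C s * M` is a projection onto the column
space of `M`. The real part of its trace is `s`, and it is also the rank of `M` (`re_trace_eq_qrank`).
So `s` is the rank, and `C s * M * M = d s * M` (`minorSum_qrank_ne_zero_and_mul_mul`).

*Drazin inverse.* For `M = A ^ (k + 1)` of rank `r`, the columns of `A ^ k` lie in the column space of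
`M`, so `(d r)⁻¹ * C r * A ^ k` satisfies the three equations of a Drazin inverse
(`isDrazinInverse_adjCoeff`), and its entries are the sums of column determinants in the statement
(`adjCoeff_mul_apply`). The row formula is the conjugate transpose of the column formula, because
starring turns column determinants into row determinants and the Drazin inverse is Hermitian.
-/

noncomputable section

namespace QuatDrazin

/-! ### Cycle products and the star operation -/

section Cycles
open Equiv
variable {ι κ R : Type*} [Ring R]

theorem star_list_prod [StarRing R] (l : List R) : star l.prod = (l.map star).reverse.prod := by
  induction l with
  | nil => simp
  | cons a l ih => simp [ih]

/-- Cycle products are compared along an injective map of index sets that carries the orbit of one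
opening onto the orbit of the other. -/
theorem cycleProd_eq_of_semiconj {A : Matrix ι ι R} {B : Matrix κ κ R} {σ : Perm ι} {τ : Perm κ}
    {f : ι → κ} (hf : Function.Injective f) {c : ι} (h : ∀ m : ℕ, f ((σ ^ m) c) = (τ ^ m) (f c))
    (hAB : ∀ m : ℕ, A ((σ ^ m) c) ((σ ^ (m + 1)) c) = B ((τ ^ m) (f c)) ((τ ^ (m + 1)) (f c))) :
    cycleProd A σ c = cycleProd B τ (f c) := by
  have hp : Function.minimalPeriod σ c = Function.minimalPeriod τ (f c) := by
    rw [Function.minimalPeriod_eq_minimalPeriod_iff]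
    intro n
    simp only [Function.IsPeriodicPt, Function.IsFixedPt, Perm.iterate_eq_pow, ← h, hf.eq_iff]
  unfold cycleProd
  rw [hp]
  simp only [hAB]

theorem cycleProd_congr {A B : Matrix ι ι R} {σ τ : Perm ι} {c : ι}
    (h : ∀ m : ℕ, (σ ^ m) c = (τ ^ m) c)
    (hAB : ∀ m : ℕ, A ((τ ^ m) c) ((τ ^ (m + 1)) c) = B ((τ ^ m) c) ((τ ^ (m + 1)) c)) :
    cycleProd A σ c = cycleProd B τ c :=
  cycleProd_eq_of_semiconj (f := id) Function.injective_id h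
    (by intro m; rw [h, h]; exact hAB m)

theorem cycleProd_updateCol_of_not_sameCycle [DecidableEq ι] (A : Matrix ι ι R) (i : ι)
    (b : ι → R) {σ : Perm ι} {c : ι} (h : ¬ σ.SameCycle i c) :
    cycleProd (A.updateCol i b) σ c = cycleProd A σ c := by
  refine cycleProd_congr (fun _ => rfl) fun m => Matrix.updateCol_ne ?_
  rintro hm
  exact h ⟨-((m + 1 : ℕ) : ℤ), by rw [← hm, zpow_neg, zpow_natCast]; simp⟩

theorem cycleProd_of_fixed (M : Matrix ι ι R) {σ : Perm ι} {i : ι} (h : σ i = i) :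
    cycleProd M σ i = M i i := by
  have : Function.minimalPeriod σ i = 1 := Function.minimalPeriod_eq_one_iff_isFixedPt.2 h
  simp [cycleProd, this, h]

/-- Starring reverses a cycle product, so the cycle is run through backwards from the same
opening. -/
theorem star_cycleProd [StarRing R] (A : Matrix ι ι R) (σ : Perm ι) (c : ι) :
    star (cycleProd A σ c) = cycleProd A.conjTranspose σ⁻¹ c := by
  have hp : Function.minimalPeriod (σ⁻¹ : Perm ι) c = Function.minimalPeriod σ c := by
    rw [Function.minimalPeriod_eq_minimalPeriod_iff]
    intro n
    simp only [Function.IsPeriodicPt, Function.IsFixedPt, Perm.iterate_eq_pow, inv_pow,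
      Perm.inv_eq_iff_eq]
    exact eq_comm
  unfold cycleProd
  rw [star_list_prod, hp, List.map_map, ← List.map_reverse]
  congr 1
  refine List.ext_getElem (by simp) fun m h1 h2 => ?_
  simp only [List.length_map, List.length_range] at h2
  have hper : (σ ^ Function.minimalPeriod σ c) c = c := by
    rw [← Perm.iterate_eq_pow]; exact Function.iterate_minimalPeriod
  have key : ∀ q, q ≤ Function.minimalPeriod σ c →
      (σ ^ (Function.minimalPeriod σ c - q)) c = ((σ⁻¹) ^ q) c := by
    intro q hq
    rw [inv_pow, Perm.eq_inv_iff_eq, ← Perm.mul_apply, ← pow_add, Nat.add_sub_cancel' hq, hper]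
  simp only [List.getElem_map, List.getElem_reverse, List.getElem_range, List.length_range,
    Function.comp_apply, Matrix.conjTranspose_apply]
  rw [← key m h2.le, ← key (m + 1) h2, show Function.minimalPeriod σ c - 1 - m + 1 =
    Function.minimalPeriod σ c - m by omega, show Function.minimalPeriod σ c - 1 - m =
    Function.minimalPeriod σ c - (m + 1) by omega]

theorem rdet_eq_star_cdet [Fintype ι] [LinearOrder ι] [StarRing R] (i : ι) (A : Matrix ι ι R) :
    rdet i A = star (cdet i A.conjTranspose) := by
  unfold rdet cdet
  rw [star_sum, ← Equiv.sum_comp (Equiv.inv (Perm ι))]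
  refine Finset.sum_congr rfl fun σ _ => ?_
  have hh : cycleHeads σ⁻¹ i = cycleHeads σ i := by
    simp only [cycleHeads, Perm.sameCycle_inv]
  have hc : Commute ((Perm.sign σ : ℤ) : R)
      ((cycleHeads σ i).map (cycleProd A σ⁻¹)).prod := Int.cast_commute _ _
  have hf : (star ∘ cycleProd A.conjTranspose σ : ι → R) = cycleProd A σ⁻¹ := by
    funext c
    simp [star_cycleProd]
  simp only [Equiv.inv_apply, Perm.sign_inv, hh, star_mul, star_intCast,
    star_list_prod, List.map_map, hf, List.map_reverse, List.reverse_reverse]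
  exact hc.eq

end Cycles

theorem updateCol_col_self {ι R : Type*} [DecidableEq ι] (A : Matrix ι ι R) (c : ι) :
    A.updateCol c (A.col c) = A := by
  ext x y
  by_cases h : y = c
  · subst h; simp
  · simp [h]

/-! ### Inserting a point into a cycle -/

section Splice
open Equiv
variable {ι R : Type*} [DecidableEq ι] [Ring R]

/-- If `τ` fixes `i` and `y ≠ i`, then `swap i y * τ` has the cycles of `τ`, except that `i` is
inserted in front of `y`. Started at `i`, its orbit runs through the `τ`-orbit of `y`. -/
theorem splice_pow_succ {τ : Perm ι} {i y : ι} (hi : τ i = i) (hy : y ≠ i) :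
    ∀ m : ℕ, m < Function.minimalPeriod τ y → ((swap i y * τ) ^ (m + 1)) i = (τ ^ m) y := by
  intro m
  induction m with
  | zero => intro _; simp [hi]
  | succ m ih =>
    intro hm
    have h1 : (τ ^ (m + 1)) y ≠ y := by
      intro h
      rw [← Perm.iterate_eq_pow] at h
      exact Function.not_isPeriodicPt_of_pos_of_lt_minimalPeriod (Nat.succ_ne_zero m) hm h
    have h2 : (τ ^ (m + 1)) y ≠ i := by
      intro h
      apply hy
      apply (τ ^ (m + 1)).injective
      rw [h, Perm.pow_apply_eq_self_of_apply_eq_self hi]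
    rw [pow_succ', Perm.mul_apply, ih (by omega), Perm.mul_apply, ← Perm.mul_apply τ, ← pow_succ',
      swap_apply_of_ne_of_ne h2 h1]

theorem splice_pow_period_succ [Finite ι] {τ : Perm ι} {i y : ι} (hi : τ i = i) (hy : y ≠ i) :
    ((swap i y * τ) ^ (Function.minimalPeriod τ y + 1)) i = i := by
  obtain ⟨p, hp⟩ : ∃ p, Function.minimalPeriod τ y = p + 1 :=
    Nat.exists_eq_succ_of_ne_zero (Function.minimalPeriod_pos_of_mem_periodicPts
      (Function.mem_periodicPts.2 ⟨orderOf τ, orderOf_pos τ, by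
        rw [Function.IsPeriodicPt, Function.IsFixedPt, Perm.iterate_eq_pow, pow_orderOf_eq_one]
        rfl⟩)).ne'
  have h : (τ ^ (p + 1)) y = y := by
    rw [← hp, ← Perm.iterate_eq_pow]; exact Function.iterate_minimalPeriod
  rw [hp, pow_succ', Perm.mul_apply, splice_pow_succ hi hy p (by omega), Perm.mul_apply,
    ← Perm.mul_apply τ, ← pow_succ', h, swap_apply_right]

theorem minimalPeriod_splice [Finite ι] {τ : Perm ι} {i y : ι} (hi : τ i = i) (hy : y ≠ i) :
    Function.minimalPeriod (swap i y * τ : Perm ι) i = Function.minimalPeriod τ y + 1 := by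
  have hper : Function.IsPeriodicPt (swap i y * τ : Perm ι) (Function.minimalPeriod τ y + 1) i := by
    rw [Function.IsPeriodicPt, Function.IsFixedPt, Perm.iterate_eq_pow]
    exact splice_pow_period_succ hi hy
  refine le_antisymm (hper.minimalPeriod_le (Nat.succ_pos _)) ?_
  by_contra! hlt
  have hpos := hper.minimalPeriod_pos (Nat.succ_pos _)
  obtain ⟨q, hq⟩ := Nat.exists_eq_succ_of_ne_zero hpos.ne'
  have h : ((swap i y * τ) ^ (q + 1)) i = i := by
    rw [← Nat.succ_eq_add_one, ← hq, ← Perm.iterate_eq_pow]; exact Function.iterate_minimalPeriod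
  rw [splice_pow_succ hi hy q (by omega)] at h
  apply hy
  apply (τ ^ q).injective
  rw [h, Perm.pow_apply_eq_self_of_apply_eq_self hi]

/-- Inserting `i` in front of `y` prepends the factor `M i y`; the last factor of either cycle
product comes from the replaced column `b`. -/
theorem cycleProd_splice [Finite ι] (M : Matrix ι ι R) (b : ι → R) {τ : Perm ι} {i y : ι}
    (hi : τ i = i) (hy : y ≠ i) :
    cycleProd (M.updateCol i b) (swap i y * τ) i = M i y * cycleProd (M.updateCol y b) τ y := by
  unfold cycleProd
  rw [minimalPeriod_splice hi hy, List.range_succ_eq_map, List.map_cons, List.prod_cons,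
    List.map_map]
  congr 1
  · simp [hi, hy]
  congr 1
  refine List.map_congr_left fun m hm => ?_
  rw [List.mem_range] at hm
  have h0 : ((swap i y * τ) ^ (m + 1)) i = (τ ^ m) y := splice_pow_succ hi hy m hm
  simp only [Function.comp_apply, Nat.succ_eq_add_one, h0]
  rcases (Nat.succ_le_of_lt hm).lt_or_eq with h | h
  · rw [splice_pow_succ hi hy (m + 1) h]
    have h1 : (τ ^ (m + 1)) y ≠ y := by
      intro h'
      rw [← Perm.iterate_eq_pow] at h'
      exact Function.not_isPeriodicPt_of_pos_of_lt_minimalPeriod (Nat.succ_ne_zero m) h h'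
    have h2 : (τ ^ (m + 1)) y ≠ i := by
      intro h'
      apply hy
      apply (τ ^ (m + 1)).injective
      rw [h', Perm.pow_apply_eq_self_of_apply_eq_self hi]
    rw [Matrix.updateCol_ne h2, Matrix.updateCol_ne h1]
  · have h1 : (τ ^ (m + 1)) y = y := by
      rw [← Nat.succ_eq_add_one, h, ← Perm.iterate_eq_pow]; exact Function.iterate_minimalPeriod
    have h2 : ((swap i y * τ) ^ (m + 1 + 1)) i = i := by
      rw [← Nat.succ_eq_add_one m, h]; exact splice_pow_period_succ hi hy
    rw [h1, h2, Matrix.updateCol_self, Matrix.updateCol_self]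

theorem sameCycle_splice_iff [Finite ι] {τ : Perm ι} {i y : ι} (hi : τ i = i) (d : ι) :
    (swap i y * τ).SameCycle i d ↔ d = i ∨ τ.SameCycle y d := by
  have hsi : (swap i y * τ) i = y := by simp [hi]
  constructor
  · intro h
    obtain ⟨m, -, -, rfl⟩ := h.exists_pow_eq''
    induction m with
    | zero => simp
    | succ m ih =>
      rw [pow_succ', Perm.mul_apply]
      rcases ih ⟨m, by simp⟩ with h | h
      · rw [h, hsi]; exact Or.inr (Perm.SameCycle.refl _ _)
      · rw [Perm.mul_apply]
        by_cases h1 : τ (((swap i y * τ) ^ m) i) = i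
        · rw [h1, swap_apply_left]; exact Or.inr (Perm.SameCycle.refl _ _)
        by_cases h2 : τ (((swap i y * τ) ^ m) i) = y
        · rw [h2, swap_apply_right]; exact Or.inl rfl
        rw [swap_apply_of_ne_of_ne h1 h2, Perm.sameCycle_apply_right]
        exact Or.inr h
  · rintro (rfl | h)
    · exact Perm.SameCycle.refl _ _
    obtain ⟨m, -, -, rfl⟩ := h.exists_pow_eq''
    clear h
    have hy : (swap i y * τ).SameCycle i y := ⟨1, by simp [hi]⟩
    induction m with
    | zero => simpa using hy
    | succ m ih =>
      rw [pow_succ', Perm.mul_apply]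
      by_cases h2 : τ ((τ ^ m) y) = y
      · rwa [h2]
      by_cases h1 : τ ((τ ^ m) y) = i
      · rw [h1]
      rw [← Perm.sameCycle_apply_right, Perm.mul_apply, swap_apply_of_ne_of_ne h1 h2] at ih
      exact ih

theorem splice_pow_of_not_sameCycle {τ : Perm ι} {i y c : ι} (hi : τ i = i)
    (hc : c ≠ i) (hyc : ¬ τ.SameCycle y c) (m : ℕ) : ((swap i y * τ) ^ m) c = (τ ^ m) c := by
  induction m with
  | zero => rfl
  | succ m ih =>
    rw [pow_succ', Perm.mul_apply, ih, Perm.mul_apply, ← Perm.mul_apply τ, ← pow_succ',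
      swap_apply_of_ne_of_ne]
    · intro h
      apply hc
      apply (τ ^ (m + 1)).injective
      rw [h, Perm.pow_apply_eq_self_of_apply_eq_self hi]
    · intro h
      refine hyc (Perm.SameCycle.symm ⟨(m + 1 : ℕ), ?_⟩)
      rw [zpow_natCast, h]

theorem sameCycle_splice_iff_of_not_sameCycle [Finite ι] {τ : Perm ι} {i y c : ι} (hi : τ i = i)
    (hc : c ≠ i) (hyc : ¬ τ.SameCycle y c) (d : ι) :
    (swap i y * τ).SameCycle c d ↔ τ.SameCycle c d := by
  constructor <;> intro h <;> obtain ⟨m, -, -, rfl⟩ := h.exists_pow_eq'' <;> refine ⟨m, ?_⟩ <;>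
    rw [zpow_natCast, splice_pow_of_not_sameCycle hi hc hyc]

end Splice

/-! ### Products over the cycles of a permutation -/

section Heads
open Equiv
variable {ι R : Type*} [LinearOrder ι] [Ring R]

/-- The product of the cycles of `σ` opened by the elements of `S`, taken from right to left in
increasing order of the openings. -/
def headProd (M : Matrix ι ι R) (σ : Perm ι) (S : Finset ι) : R :=
  (S.sort.reverse.map (cycleProd M σ)).prod

theorem headProd_congr {M : Matrix ι ι R} {σ τ : Perm ι} {S S' : Finset ι} (hS : S = S')
    (h : ∀ c ∈ S, cycleProd M σ c = cycleProd M τ c) : headProd M σ S = headProd M τ S' := by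
  subst hS
  unfold headProd
  congr 1
  exact List.map_congr_left fun c hc => h c (by simpa using hc)

theorem sameCycle_ofSubtype_iff {β : Finset ι} (σ : Perm β) (c d : β) :
    (Perm.ofSubtype σ).SameCycle (c : ι) (d : ι) ↔ σ.SameCycle c d := by
  constructor <;> rintro ⟨m, hm⟩ <;> refine ⟨m, ?_⟩
  · rw [← map_zpow, Perm.ofSubtype_apply_coe] at hm
    exact Subtype.ext hm
  · rw [← map_zpow, Perm.ofSubtype_apply_coe, hm]

theorem cycleProd_submatrix {β : Finset ι} (A : Matrix ι ι R) (σ : Perm β) (c : β) :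
    cycleProd (principal A β) σ c = cycleProd A (Perm.ofSubtype σ) c := by
  refine cycleProd_eq_of_semiconj (f := Subtype.val) Subtype.val_injective ?_ ?_
  · intro m; rw [← map_pow, Perm.ofSubtype_apply_coe]
  · intro m; simp only [← map_pow, Perm.ofSubtype_apply_coe]; rfl

theorem mem_of_sameCycle_ofSubtype {β : Finset ι} (σ : Perm β) (c : β) {d : ι}
    (h : (Perm.ofSubtype σ).SameCycle (c : ι) d) : d ∈ β := by
  obtain ⟨m, rfl⟩ := h
  rw [← map_zpow, Perm.ofSubtype_apply_coe]
  exact Subtype.property _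

end Heads

/-! ### Expansion of column determinants along a first step -/

section Expansion
open Equiv
variable {ι R : Type*} [Fintype ι] [LinearOrder ι] [Ring R]

/-- The permutations of `ι` that fix every point outside `T`. -/
def permsOn (T : Finset ι) : Finset (Perm ι) :=
  Finset.univ.filter fun σ => ∀ x, x ∉ T → σ x = x

/-- The elements of `T` that are least in their `σ`-cycle. -/
def cycleMinima (T : Finset ι) (σ : Perm ι) : Finset ι :=
  T.filter fun c => ∀ d, σ.SameCycle c d → c ≤ d

/-- The column determinant at `i` of the principal submatrix of `M` on `T`, with column `i`
replaced by `b`, and with the factor `z` inserted in front of the cycle of `i`. -/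
def colExp (M : Matrix ι ι R) (T : Finset ι) (i : ι) (z : R) (b : ι → R) : R :=
  ∑ σ ∈ permsOn T, ((Perm.sign σ : ℤ) : R) *
    (headProd M σ ((cycleMinima T σ).filter fun c => ¬ σ.SameCycle i c) * z *
      cycleProd (M.updateCol i b) σ i)

/-- The column determinant at the least index of the principal submatrix of `M` on `T`, which is
`1` for `T = ∅`. -/
def minor (M : Matrix ι ι R) (T : Finset ι) : R :=
  ∑ σ ∈ permsOn T, ((Perm.sign σ : ℤ) : R) * headProd M σ (cycleMinima T σ)

theorem mem_permsOn {T : Finset ι} {σ : Perm ι} : σ ∈ permsOn T ↔ ∀ x, x ∉ T → σ x = x := by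
  simp [permsOn]

/-- A permutation on `T` is uniquely `swap i y * τ` with `y ∈ T` and `τ` a permutation on
`T.erase i`. -/
theorem sum_permsOn {T : Finset ι} {i : ι} (hi : i ∈ T) (f : Perm ι → R) :
    ∑ σ ∈ permsOn T, f σ = ∑ y ∈ T, ∑ τ ∈ permsOn (T.erase i), f (swap i y * τ) := by
  rw [← Finset.sum_product']
  symm
  refine Finset.sum_bij' (fun x _ => swap i x.1 * x.2) (fun σ _ => (σ i, swap i (σ i) * σ))
    ?_ ?_ ?_ ?_ ?_
  · rintro ⟨y, τ⟩ h
    simp only [Finset.mem_product, mem_permsOn, Finset.mem_erase, not_and] at h ⊢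
    intro x hx
    rw [Perm.mul_apply, h.2 x fun _ => hx, swap_apply_of_ne_of_ne]
    · rintro rfl; exact hx hi
    · rintro rfl; exact hx h.1
  · intro σ h
    simp only [Finset.mem_product, mem_permsOn, Finset.mem_erase, not_and] at h ⊢
    have hm : σ i ∈ T := by
      by_contra hn
      have := σ.injective (h _ hn)
      exact hn (this.symm ▸ hi)
    refine ⟨hm, fun x hx => ?_⟩
    by_cases hxi : x = i
    · subst hxi; simp
    · rw [Perm.mul_apply, h x (hx hxi), swap_apply_of_ne_of_ne hxi]
      rintro rfl; exact hx hxi hm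
  · rintro ⟨y, τ⟩ h
    simp only [Finset.mem_product, mem_permsOn, Finset.mem_erase, not_and] at h
    have hτ : τ i = i := h.2 i fun h => absurd rfl h
    simp [hτ, ← mul_assoc]
  · intro σ h
    simp [← mul_assoc]
  · intros; rfl

/-- Expansion of a column determinant along the first step `i ↦ y` of the cycle of `i`. The factor
`M i y` joins `z` between the other cycles and the shortened cycle, which is opened by `y`. -/
theorem colExp_eq (M : Matrix ι ι R) {T : Finset ι} {i : ι} (hi : i ∈ T) (z : R) (b : ι → R) :
    colExp M T i z b = minor M (T.erase i) * z * b i -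
      ∑ y ∈ T.erase i, colExp M (T.erase i) y (z * M i y) b := by
  rw [colExp, sum_permsOn hi, ← Finset.add_sum_erase _ _ hi, sub_eq_add_neg,
    ← Finset.sum_neg_distrib]
  congr 1
  · rw [minor, Finset.sum_mul, Finset.sum_mul]
    refine Finset.sum_congr rfl fun τ hτ => ?_
    have hτi : τ i = i := mem_permsOn.1 hτ i (by simp)
    rw [swap_self]
    simp only [← Perm.one_def, one_mul]
    rw [cycleProd_of_fixed _ hτi, Matrix.updateCol_self, mul_assoc, mul_assoc, mul_assoc]
    congr 2
    refine headProd_congr ?_ fun _ _ => rfl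
    ext c
    have : τ.SameCycle i c ↔ c = i := by
      constructor
      · rintro ⟨m, rfl⟩; exact Perm.zpow_apply_eq_self_of_apply_eq_self hτi m
      · rintro rfl; exact Perm.SameCycle.refl _ _
    simp only [cycleMinima, Finset.mem_filter, Finset.mem_erase, this]
    tauto
  · refine Finset.sum_congr rfl fun y hy => ?_
    rw [colExp, ← Finset.sum_neg_distrib]
    refine Finset.sum_congr rfl fun τ hτ => ?_
    have hτi : τ i = i := mem_permsOn.1 hτ i (by simp)
    have hyi : y ≠ i := Finset.ne_of_mem_erase hy
    rw [cycleProd_splice M b hτi hyi, Perm.sign_mul, Perm.sign_swap hyi.symm]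
    have hset : (cycleMinima T (swap i y * τ)).filter (fun c => ¬ (swap i y * τ).SameCycle i c) =
        (cycleMinima (T.erase i) τ).filter fun c => ¬ τ.SameCycle y c := by
      ext c
      simp only [cycleMinima, Finset.mem_filter, Finset.mem_erase, sameCycle_splice_iff hτi, not_or]
      constructor
      · rintro ⟨⟨h1, h2⟩, h3, h4⟩
        exact ⟨⟨⟨h3, h1⟩, fun d hd =>
          h2 d ((sameCycle_splice_iff_of_not_sameCycle hτi h3 h4 d).2 hd)⟩, h4⟩
      · rintro ⟨⟨⟨h3, h1⟩, h2⟩, h4⟩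
        exact ⟨⟨h1, fun d hd =>
          h2 d ((sameCycle_splice_iff_of_not_sameCycle hτi h3 h4 d).1 hd)⟩, h3, h4⟩
    have hprod : headProd M (swap i y * τ)
        ((cycleMinima T (swap i y * τ)).filter (fun c => ¬ (swap i y * τ).SameCycle i c)) =
        headProd M τ ((cycleMinima (T.erase i) τ).filter fun c => ¬ τ.SameCycle y c) := by
      refine headProd_congr hset fun c hc => ?_
      rw [hset] at hc
      simp only [cycleMinima, Finset.mem_filter, Finset.mem_erase] at hc
      exact cycleProd_congr (splice_pow_of_not_sameCycle hτi hc.1.1.1 hc.2) fun _ => rfl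
    rw [hprod]
    simp [mul_assoc]

theorem minor_empty (M : Matrix ι ι R) : minor M ∅ = 1 := by
  have : permsOn (∅ : Finset ι) = {1} := by
    ext σ
    simp [mem_permsOn, Perm.ext_iff]
  simp [minor, this, headProd, cycleMinima]

theorem minor_eq_colExp (M : Matrix ι ι R) {T : Finset ι} (hT : T.Nonempty) :
    minor M T = colExp M T (T.min' hT) 1 (M.col (T.min' hT)) := by
  refine Finset.sum_congr rfl fun σ hσ => ?_
  rw [mem_permsOn] at hσ
  set c := T.min' hT with hc
  have hcT : c ∈ T := T.min'_mem hT
  have hcyc : ∀ d, σ.SameCycle c d → d ∈ T := by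
    intro d hd
    by_contra hdT
    have := (hd.apply_eq_self_iff).2 (hσ d hdT)
    obtain ⟨m, rfl⟩ := hd
    rw [Perm.zpow_apply_eq_self_of_apply_eq_self this] at hdT
    exact hdT hcT
  have hset : cycleMinima T σ =
      insert c ((cycleMinima T σ).filter fun d => ¬ σ.SameCycle c d) := by
    ext d
    simp only [cycleMinima, Finset.mem_insert, Finset.mem_filter]
    constructor
    · rintro ⟨h1, h2⟩
      by_cases hcd : σ.SameCycle c d
      · exact Or.inl (le_antisymm (h2 c hcd.symm) (T.min'_le d h1))
      · exact Or.inr ⟨⟨h1, h2⟩, hcd⟩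
    · rintro (rfl | h)
      · exact ⟨hcT, fun d hd => T.min'_le d (hcyc d hd)⟩
      · exact h.1
  rw [updateCol_col_self, mul_one]
  congr 1
  conv_lhs => rw [hset]
  rw [headProd, Finset.sort_insert]
  · simp [headProd]
  · intro d hd
    simp only [cycleMinima, Finset.mem_filter] at hd
    exact T.min'_le d hd.1.1
  · simp [Perm.SameCycle.refl]

end Expansion

/-! ### Determinants of principal submatrices -/

section Principal
open Equiv
variable {ι R : Type*} [Fintype ι] [LinearOrder ι] [Ring R]

theorem sum_perm_subtype (β : Finset ι) (f : Perm ι → R) :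
    ∑ σ : Perm β, f (Perm.ofSubtype σ) = ∑ σ ∈ permsOn β, f σ := by
  rw [Finset.sum_subtype (p := fun σ : Perm ι => ∀ x, x ∉ β → σ x = x) (permsOn β)
    (fun σ => mem_permsOn) f, ← (Perm.subtypeEquivSubtypePerm (· ∈ β)).sum_comp]
  rfl

theorem cdet_principal_updateCol (A : Matrix ι ι R) (β : Finset ι) (i : ι) (hi : i ∈ β)
    (b : ι → R) :
    cdet (⟨i, hi⟩ : β) (principal (A.updateCol i b) β) = colExp A β i 1 b := by
  unfold cdet colExp
  rw [← sum_perm_subtype β]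
  refine Finset.sum_congr rfl fun σ _ => ?_
  rw [Perm.sign_ofSubtype, mul_one]
  congr 1
  rw [cycleHeads, List.reverse_cons, List.map_append, List.prod_append]
  congr 1
  · rw [headProd]
    have hs : ((cycleMinima β (Perm.ofSubtype σ)).filter
        fun c => ¬ (Perm.ofSubtype σ).SameCycle i c).sort =
        ((Finset.univ.filter fun c : β => ¬ σ.SameCycle ⟨i, hi⟩ c ∧
          ∀ d, σ.SameCycle c d → c ≤ d).sort).map Subtype.val := by
      have hm := StrictMonoOn.map_finsetSort (f := Function.Embedding.subtype (· ∈ β))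
        (s := Finset.univ.filter fun c : β => ¬ σ.SameCycle ⟨i, hi⟩ c ∧
          ∀ d, σ.SameCycle c d → c ≤ d) (fun a _ b _ h => h)
      rw [Function.Embedding.coe_subtype] at hm
      rw [hm]
      congr 1
      ext c
      simp only [cycleMinima, Finset.mem_filter, Finset.mem_map, Finset.mem_univ, true_and,
        Function.Embedding.coe_subtype]
      constructor
      · rintro ⟨⟨h1, h2⟩, h3⟩
        refine ⟨⟨c, h1⟩, ⟨fun h => h3 ((sameCycle_ofSubtype_iff σ ⟨i, hi⟩ ⟨c, h1⟩).2 h),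
          fun d hd => h2 d ((sameCycle_ofSubtype_iff σ ⟨c, h1⟩ d).2 hd)⟩, rfl⟩
      · rintro ⟨c, ⟨h1, h2⟩, rfl⟩
        refine ⟨⟨c.2, fun d hd => ?_⟩, fun h => h1 ((sameCycle_ofSubtype_iff σ ⟨i, hi⟩ c).1 h)⟩
        have hdm := mem_of_sameCycle_ofSubtype σ c hd
        exact h2 ⟨d, hdm⟩ ((sameCycle_ofSubtype_iff σ c ⟨d, hdm⟩).1 hd)
    rw [hs, ← List.map_reverse, List.map_map]
    congr 1
    refine List.map_congr_left fun c hc => ?_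
    rw [cycleProd_submatrix, Function.comp_apply, cycleProd_updateCol_of_not_sameCycle]
    simp only [List.mem_reverse, Finset.mem_sort, Finset.mem_filter] at hc
    rw [← sameCycle_ofSubtype_iff] at hc
    exact hc.2.1
  · simp [cycleProd_submatrix]

theorem hdet_principal [StarRing R] (A : Matrix ι ι R) (β : Finset ι) :
    hdet (principal A β) = star (minor A.conjTranspose β) := by
  rcases β.eq_empty_or_nonempty with rfl | hβ
  · rw [minor_empty, hdet, dif_neg (by simp), star_one]
  have hne : (Finset.univ : Finset β).Nonempty := ⟨⟨_, hβ.choose_spec⟩, Finset.mem_univ _⟩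
  have hmin : Finset.univ.min' hne = (⟨β.min' hβ, β.min'_mem hβ⟩ : β) :=
    le_antisymm (Finset.min'_le _ _ (Finset.mem_univ _))
      (Finset.le_min' _ _ _ fun y _ => β.min'_le y y.2)
  rw [hdet, dif_pos hne, hmin, rdet_eq_star_cdet, minor_eq_colExp _ hβ,
    ← cdet_principal_updateCol _ _ _ (β.min'_mem hβ), updateCol_col_self]
  rfl

end Principal

/-! ### Cofactors of Hermitian matrices and Cramer's rule -/

section Hermitian
variable {ι : Type*} [Fintype ι] [LinearOrder ι]

theorem mul_comm_of_star_eq {a : ℍ[ℝ]} (ha : star a = a) (b : ℍ[ℝ]) : a * b = b * a := by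
  rw [Quaternion.star_eq_self.1 ha]
  exact Quaternion.coe_commutes _ _

/-- The cofactor of position `(l, i)` in the principal submatrix on `T`, namely the left coefficient
of `b l` in the column determinant at `i` with column `i` replaced by `b`. -/
def cofactor (M : Matrix ι ι ℍ[ℝ]) (T : Finset ι) (i l : ι) : ℍ[ℝ] :=
  colExp M T i 1 (Pi.single l 1)

/-- The facts on the principal submatrix on `T` of a Hermitian matrix that an induction on `T`
has to carry: `b` enters linearly, the principal minor is real, the cofactors are Hermitian, and
the first or the last step of the path behind a cofactor can be split off. -/
structure CofactorRules (M : Matrix ι ι ℍ[ℝ]) (T : Finset ι) : Prop where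
  colExp_eq_sum : ∀ i ∈ T, ∀ z b, colExp M T i z b = z * ∑ l ∈ T, cofactor M T i l * b l
  star_minor : star (minor M T) = minor M T
  star_cofactor : ∀ i ∈ T, ∀ l ∈ T, star (cofactor M T i l) = cofactor M T l i
  self_eq : ∀ i ∈ T, cofactor M T i i = minor M (T.erase i)
  left_rec : ∀ i ∈ T, ∀ l ∈ T, i ≠ l → cofactor M T i l =
    -∑ y ∈ T.erase i, M i y * cofactor M (T.erase i) y l
  right_rec : ∀ i ∈ T, ∀ l ∈ T, i ≠ l → cofactor M T i l =
    -∑ z ∈ T.erase l, cofactor M (T.erase l) i z * M z l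

theorem colExp_step {M : Matrix ι ι ℍ[ℝ]} {T : Finset ι} {i : ι} (hi : i ∈ T)
    (h : CofactorRules M (T.erase i)) (z : ℍ[ℝ]) (b : ι → ℍ[ℝ]) :
    colExp M T i z b = z * (minor M (T.erase i) * b i -
      ∑ y ∈ T.erase i, M i y * ∑ l ∈ T.erase i, cofactor M (T.erase i) y l * b l) := by
  rw [colExp_eq M hi, mul_sub, mul_comm_of_star_eq h.star_minor, mul_assoc, Finset.mul_sum]
  congr 1
  refine Finset.sum_congr rfl fun y hy => ?_
  rw [h.colExp_eq_sum y hy, mul_assoc]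

/-- The determinant expanded at `i` is real, being a Hermitian form in the entries of row `i`. -/
theorem star_colExp_col {M : Matrix ι ι ℍ[ℝ]} (hM : M.IsHermitian) {T : Finset ι} {i : ι}
    (hi : i ∈ T) (h : CofactorRules M (T.erase i)) :
    star (colExp M T i 1 (M.col i)) = colExp M T i 1 (M.col i) := by
  have hs : ∀ x y, star (M x y) = M y x := fun x y => hM.apply y x
  rw [colExp_step hi h, one_mul, star_sub, star_mul, h.star_minor, Matrix.col_apply, hs,
    mul_comm_of_star_eq h.star_minor]
  congr 1
  simp only [star_sum, star_mul, Finset.mul_sum, Matrix.col_apply, hs]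
  rw [Finset.sum_comm]
  refine Finset.sum_congr rfl fun y hy => Finset.sum_congr rfl fun l hl => ?_
  rw [h.star_cofactor _ hl _ hy, mul_assoc]

theorem cofactorRules {M : Matrix ι ι ℍ[ℝ]} (hM : M.IsHermitian) (T : Finset ι) :
    CofactorRules M T := by
  induction T using Finset.strongInduction with
  | H T ih =>
  have hs : ∀ x y, star (M x y) = M y x := fun x y => hM.apply y x
  have ihe : ∀ i ∈ T, CofactorRules M (T.erase i) := fun i hi => ih _ (Finset.erase_ssubset hi)
  have self_eq : ∀ i ∈ T, cofactor M T i i = minor M (T.erase i) := by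
    intro i hi
    rw [cofactor, colExp_step hi (ihe i hi), Pi.single_eq_same, one_mul, mul_one,
      Finset.sum_eq_zero, sub_zero]
    intro y _
    rw [Finset.sum_eq_zero, mul_zero]
    intro l hl
    rw [Pi.single_eq_of_ne (Finset.ne_of_mem_erase hl), mul_zero]
  have left_rec : ∀ i ∈ T, ∀ l ∈ T, i ≠ l → cofactor M T i l =
      -∑ y ∈ T.erase i, M i y * cofactor M (T.erase i) y l := by
    intro i hi l hl hil
    rw [cofactor, colExp_step hi (ihe i hi), Pi.single_eq_of_ne hil, one_mul, mul_zero, zero_sub]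
    congr 1
    refine Finset.sum_congr rfl fun y _ => ?_
    rw [Finset.sum_eq_single_of_mem l (Finset.mem_erase.2 ⟨hil.symm, hl⟩), Pi.single_eq_same,
      mul_one]
    intro x _ hx
    rw [Pi.single_eq_of_ne hx, mul_zero]
  have ihee : ∀ i ∈ T, ∀ l ∈ T.erase i, CofactorRules M ((T.erase i).erase l) := fun i hi l hl =>
    ih _ ((Finset.erase_ssubset hl).trans (Finset.erase_ssubset hi))
  -- removing the first step and the last step of a path from `i` to `l`
  have closed : ∀ i ∈ T, ∀ l ∈ T, i ≠ l → cofactor M T i l =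
      -(M i l * minor M ((T.erase i).erase l)) + ∑ y ∈ (T.erase i).erase l,
        ∑ z ∈ (T.erase i).erase l, M i y * cofactor M ((T.erase i).erase l) y z * M z l := by
    intro i hi l hl hil
    have hlS : l ∈ T.erase i := Finset.mem_erase.2 ⟨hil.symm, hl⟩
    rw [left_rec i hi l hl hil, ← Finset.add_sum_erase _ _ hlS, (ihe i hi).self_eq l hlS, neg_add,
      ← Finset.sum_neg_distrib]
    congr 1
    refine Finset.sum_congr rfl fun y hy => ?_
    rw [(ihe i hi).right_rec y (Finset.mem_of_mem_erase hy) l hlS (Finset.ne_of_mem_erase hy),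
      mul_neg, neg_neg, Finset.mul_sum]
    exact Finset.sum_congr rfl fun z _ => (mul_assoc _ _ _).symm
  refine ⟨?_, ?_, ?_, self_eq, left_rec, ?_⟩
  · intro i hi z b
    rw [colExp_step hi (ihe i hi), ← Finset.add_sum_erase T _ hi, self_eq i hi, sub_eq_add_neg]
    congr 2
    simp only [Finset.mul_sum]
    rw [Finset.sum_comm, ← Finset.sum_neg_distrib]
    refine Finset.sum_congr rfl fun l hl => ?_
    rw [left_rec i hi l (Finset.mem_of_mem_erase hl) (Finset.ne_of_mem_erase hl).symm, neg_mul,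
      Finset.sum_mul]
    simp only [mul_assoc]
  · rcases T.eq_empty_or_nonempty with rfl | hT
    · simp [minor_empty]
    · rw [minor_eq_colExp M hT]
      exact star_colExp_col hM (T.min'_mem hT) (ihe _ (T.min'_mem hT))
  · intro i hi l hl
    by_cases hil : i = l
    · subst hil
      rw [self_eq i hi, (ihe i hi).star_minor]
    have hlS : l ∈ T.erase i := Finset.mem_erase.2 ⟨Ne.symm hil, hl⟩
    have hU := ihee i hi l hlS
    rw [closed i hi l hl hil, closed l hl i hi (Ne.symm hil), Finset.erase_right_comm (a := l)]
    simp only [star_add, star_neg, star_sum, star_mul, hs, hU.star_minor]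
    rw [mul_comm_of_star_eq hU.star_minor, Finset.sum_comm]
    congr 1
    refine Finset.sum_congr rfl fun y hy => Finset.sum_congr rfl fun z hz => ?_
    rw [hU.star_cofactor _ hz _ hy, mul_assoc]
  · intro i hi l hl hil
    have hlS : l ∈ T.erase i := Finset.mem_erase.2 ⟨hil.symm, hl⟩
    have hiS : i ∈ T.erase l := Finset.mem_erase.2 ⟨hil, hi⟩
    have hU := ihee i hi l hlS
    rw [closed i hi l hl hil, ← Finset.add_sum_erase (T.erase l) _ hiS, (ihe l hl).self_eq i hiS,
      neg_add, Finset.erase_right_comm (a := l), mul_comm_of_star_eq hU.star_minor, Finset.sum_comm,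
      ← Finset.sum_neg_distrib]
    congr 1
    refine Finset.sum_congr rfl fun z hz => ?_
    rw [(ihe l hl).left_rec i hiS z (Finset.mem_of_mem_erase (Finset.erase_right_comm (a := l) ▸ hz))
      (fun h => by subst h; simp at hz), neg_mul, neg_neg, Finset.sum_mul,
      Finset.erase_right_comm (a := l)]

theorem continuous_colExp_col {M : ℝ → Matrix ι ι ℍ[ℝ]}
    (hM : ∀ x y, Continuous fun t => M t x y) (T : Finset ι) (i : ι) :
    Continuous fun t => colExp (M t) T i 1 ((M t).col i) := by
  have hc : ∀ (σ : Equiv.Perm ι) c, Continuous fun t => cycleProd (M t) σ c := fun σ c =>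
    continuous_list_prod _ fun m _ => hM _ _
  unfold colExp headProd
  simp only [updateCol_col_self]
  refine continuous_finsetSum _ fun σ _ => continuous_const.mul (((continuous_list_prod _ ?_).mul
    continuous_const).mul (hc _ _))
  exact fun c _ => hc σ c

/-- Cramer's rule for Hermitian matrices: the cofactors form an adjugate. -/
theorem sum_cofactor_mul (T : Finset ι) : ∀ {M : Matrix ι ι ℍ[ℝ]}, M.IsHermitian →
    ∀ i ∈ T, ∀ j ∈ T, ∑ l ∈ T, cofactor M T i l * M l j = if i = j then minor M T else 0 := by
  induction T using Finset.strongInduction with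
  | H T ih =>
  have off : ∀ {M : Matrix ι ι ℍ[ℝ]}, M.IsHermitian → ∀ i ∈ T, ∀ j ∈ T, i ≠ j →
      ∑ l ∈ T, cofactor M T i l * M l j = 0 := by
    intro M hM i hi j hj hij
    have hjS : j ∈ T.erase i := Finset.mem_erase.2 ⟨hij.symm, hj⟩
    have h1 := (cofactorRules hM T).colExp_eq_sum i hi 1 (M.col j)
    rw [colExp_step hi (cofactorRules hM _), one_mul, one_mul] at h1
    simp only [Matrix.col_apply] at h1
    rw [← h1, Finset.sum_congr rfl fun y hy => by
      rw [ih _ (Finset.erase_ssubset hi) hM y hy j hjS]]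
    simp only [mul_ite, mul_zero, Finset.sum_ite_eq', if_pos hjS]
    rw [mul_comm_of_star_eq (cofactorRules hM _).star_minor, sub_self]
  have diag : ∀ {M : Matrix ι ι ℍ[ℝ]}, M.IsHermitian → ∀ i ∈ T,
      ∑ l ∈ T, cofactor M T i l * M l i = colExp M T i 1 (M.col i) := by
    intro M hM i hi
    rw [(cofactorRules hM T).colExp_eq_sum i hi, one_mul]; rfl
  -- `M * N * M`, with `N` the matrix of cofactors, computed in the two ways of bracketing
  have step : ∀ {M : Matrix ι ι ℍ[ℝ]}, M.IsHermitian → ∀ i ∈ T, ∀ c ∈ T, i ≠ c → M i c ≠ 0 →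
      colExp M T i 1 (M.col i) = colExp M T c 1 (M.col c) := by
    intro M hM i hi c hc hic hne
    have hs : ∀ x y, star (M x y) = M y x := fun x y => hM.apply y x
    have e1 : ∑ x ∈ T, M i x * ∑ l ∈ T, cofactor M T x l * M l c =
        M i c * colExp M T c 1 (M.col c) := by
      rw [Finset.sum_eq_single_of_mem c hc, diag hM c hc]
      intro x hx hxc
      rw [off hM x hx c hc hxc, mul_zero]
    have left : ∀ l ∈ T, ∑ x ∈ T, M i x * cofactor M T x l =
        star (∑ x ∈ T, cofactor M T l x * M x i) := by
      intro l hl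
      rw [star_sum]
      refine Finset.sum_congr rfl fun x hx => ?_
      rw [star_mul, hs, (cofactorRules hM T).star_cofactor l hl x hx]
    have e2 : ∑ x ∈ T, M i x * ∑ l ∈ T, cofactor M T x l * M l c =
        colExp M T i 1 (M.col i) * M i c := by
      simp only [Finset.mul_sum, ← mul_assoc]
      rw [Finset.sum_comm]
      simp only [← Finset.sum_mul]
      rw [Finset.sum_eq_single_of_mem i hi, left i hi, diag hM i hi,
        star_colExp_col hM hi (cofactorRules hM _)]
      intro l hl hli
      rw [left l hl, off hM l hl i hi hli, star_zero, zero_mul]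
    rw [e1, ← mul_comm_of_star_eq (star_colExp_col hM hc (cofactorRules hM _))] at e2
    exact (mul_right_cancel₀ hne e2).symm
  have indep : ∀ {M : Matrix ι ι ℍ[ℝ]}, M.IsHermitian → ∀ i ∈ T, ∀ c ∈ T,
      colExp M T i 1 (M.col i) = colExp M T c 1 (M.col c) := by
    intro M hM i hi c hc
    by_cases hic : i = c
    · rw [hic]
    by_cases hne : M i c = 0
    swap
    · exact step hM i hi c hc hic hne
    -- perturb the entries at `(i, c)` and `(c, i)`, and let the perturbation tend to zero
    let P : ℝ → Matrix ι ι ℍ[ℝ] := fun t =>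
      M + (Matrix.single i c (t : ℍ[ℝ]) + Matrix.single c i (t : ℍ[ℝ]))
    have hP : ∀ t, (P t).IsHermitian := by
      intro t
      refine hM.add ?_
      rw [Matrix.IsHermitian, Matrix.conjTranspose_add, Matrix.conjTranspose_single,
        Matrix.conjTranspose_single, Quaternion.star_coe, add_comm]
    have hPc : ∀ x y, Continuous fun t => P t x y := by
      intro x y
      simp only [P, Matrix.add_apply, Matrix.single_apply]
      have : Continuous fun t : ℝ => (t : ℍ[ℝ]) := Quaternion.continuous_coe
      refine continuous_const.add (Continuous.add ?_ ?_) <;> split_ifs <;> fun_prop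
    have hP0 : P 0 = M := by simp [P]
    have heq := Continuous.ext_on (dense_compl_singleton (0 : ℝ)) (continuous_colExp_col hPc T i)
      (continuous_colExp_col hPc T c) (fun t ht => step (hP t) i hi c hc hic (by
        have : ¬ (c = i ∧ i = c) := fun h => hic h.2
        have ht0 : (t : ℍ[ℝ]) ≠ 0 := by
          rw [← Quaternion.coe_zero]
          exact fun h => ht (Quaternion.coe_injective h)
        simpa [P, Matrix.single_apply, hne, this] using ht0))
    simpa [hP0] using congrFun heq 0
  intro M hM i hi j hj
  split_ifs with hij
  · subst hij
    rw [diag hM i hi, minor_eq_colExp M ⟨i, hi⟩]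
    exact indep hM i hi _ (T.min'_mem _)
  · exact off hM i hi j hj hij

end Hermitian

theorem re_sum {κ : Type*} (S : Finset κ) (f : κ → ℍ[ℝ]) :
    (∑ x ∈ S, f x).re = ∑ x ∈ S, (f x).re :=
  map_sum (⟨⟨fun q : ℍ[ℝ] => q.re, rfl⟩, fun _ _ => rfl⟩ : ℍ[ℝ] →+ ℝ) f S

theorem eq_zero_of_self_mul_conjTranspose {ι : Type*} [Fintype ι] {Y : Matrix ι ι ℍ[ℝ]}
    (h : Y * Y.conjTranspose = 0) :
    Y = 0 := by
  ext1 i j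
  have hi : ∑ l, Quaternion.normSq (Y i l) = 0 := by
    have := congrArg (fun q : ℍ[ℝ] => q.re) (congrFun (congrFun h i) i)
    simpa only [Matrix.mul_apply, Matrix.conjTranspose_apply, Quaternion.self_mul_star, re_sum,
      Quaternion.re_coe, Matrix.zero_apply, Quaternion.re_zero] using this
  exact Quaternion.normSq_eq_zero.1
    ((Finset.sum_eq_zero_iff_of_nonneg fun _ _ => Quaternion.normSq_nonneg).1 hi j
      (Finset.mem_univ j))

/-! ### Sums of principal minors and the adjugate of a shifted matrix -/

section CharPoly
variable {ι : Type*} [Fintype ι] [LinearOrder ι]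

theorem cofactor_of_notMem {M : Matrix ι ι ℍ[ℝ]} (hM : M.IsHermitian) {T : Finset ι} {i l : ι}
    (hi : i ∈ T) (hl : l ∉ T) : cofactor M T i l = 0 := by
  rw [cofactor, (cofactorRules hM T).colExp_eq_sum i hi, one_mul]
  refine Finset.sum_eq_zero fun x hx => ?_
  rw [Pi.single_eq_of_ne (by rintro rfl; exact hl hx), mul_zero]

/-- The sum of the principal minors of order `s`, as a real number; up to sign a coefficient of the
characteristic polynomial. By `coe_minorSum` no information is lost for Hermitian matrices. -/
def minorSum (M : Matrix ι ι ℍ[ℝ]) (s : ℕ) : ℝ :=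
  (∑ β ∈ (Finset.univ : Finset ι).powersetCard s, minor M β).re

/-- The coefficient of `t ^ (n - s)` in the adjugate of `t + M`, given as a sum of cofactors over
the index sets of cardinality `s`. -/
def adjCoeff (M : Matrix ι ι ℍ[ℝ]) (s : ℕ) : Matrix ι ι ℍ[ℝ] :=
  Matrix.of fun i l =>
    ∑ β ∈ ((Finset.univ : Finset ι).powersetCard s).filter (i ∈ ·), cofactor M β i l

theorem coe_minorSum {M : Matrix ι ι ℍ[ℝ]} (hM : M.IsHermitian) (s : ℕ) :
    (minorSum M s : ℍ[ℝ]) = ∑ β ∈ (Finset.univ : Finset ι).powersetCard s, minor M β := by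
  refine (Quaternion.star_eq_self.1 ?_).symm
  rw [star_sum]
  exact Finset.sum_congr rfl fun β _ => (cofactorRules hM β).star_minor

theorem sum_powersetCard_erase {N : Type*} [AddCommMonoid N] (s : ℕ) (a : ι)
    (f : Finset ι → N) :
    ∑ β ∈ ((Finset.univ : Finset ι).powersetCard (s + 1)).filter (a ∈ ·), f (β.erase a) =
      ∑ γ ∈ ((Finset.univ : Finset ι).powersetCard s).filter (a ∉ ·), f γ := by
  refine Finset.sum_bij' (fun β _ => β.erase a) (fun γ _ => insert a γ) ?_ ?_ ?_ ?_ ?_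
  · intro β h
    simp only [Finset.mem_filter, Finset.mem_powersetCard_univ] at h ⊢
    simp [Finset.card_erase_of_mem h.2, h.1]
  · intro γ h
    simp only [Finset.mem_filter, Finset.mem_powersetCard_univ] at h ⊢
    simp [Finset.card_insert_of_notMem h.2, h.1]
  · intro β h
    exact Finset.insert_erase (Finset.mem_filter.1 h).2
  · intro γ h
    exact Finset.erase_insert (Finset.mem_filter.1 h).2
  · intros; rfl

theorem adjCoeff_succ_diag {M : Matrix ι ι ℍ[ℝ]} (hM : M.IsHermitian) (s : ℕ) (i : ι) :
    adjCoeff M (s + 1) i i =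
      ∑ γ ∈ ((Finset.univ : Finset ι).powersetCard s).filter (i ∉ ·), minor M γ := by
  rw [← sum_powersetCard_erase s i]
  refine Finset.sum_congr rfl fun β hβ => ?_
  exact (cofactorRules hM β).self_eq i (Finset.mem_filter.1 hβ).2

/-- The Faddeev–LeVerrier recursion. -/
theorem adjCoeff_succ {M : Matrix ι ι ℍ[ℝ]} (hM : M.IsHermitian) (s : ℕ) :
    adjCoeff M (s + 1) = minorSum M s • 1 - adjCoeff M s * M := by
  ext1 i j
  have hmul : (adjCoeff M s * M) i j =
      ∑ β ∈ ((Finset.univ : Finset ι).powersetCard s).filter (i ∈ ·),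
        ∑ l ∈ β, cofactor M β i l * M l j := by
    simp only [Matrix.mul_apply, adjCoeff, Matrix.of_apply, Finset.sum_mul]
    rw [Finset.sum_comm]
    refine Finset.sum_congr rfl fun β hβ => (Finset.sum_subset (Finset.subset_univ β) ?_).symm
    intro l _ hl
    rw [cofactor_of_notMem hM (Finset.mem_filter.1 hβ).2 hl, zero_mul]
  rw [Matrix.sub_apply, hmul, Matrix.smul_apply]
  by_cases hij : i = j
  · subst hij
    rw [adjCoeff_succ_diag hM, Matrix.one_apply_eq, ← Quaternion.coe_mul_eq_smul, mul_one,
      coe_minorSum hM, eq_sub_iff_add_eq, add_comm,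
      ← Finset.sum_filter_add_sum_filter_not (Finset.powersetCard s Finset.univ) (i ∈ ·)]
    congr 1
    refine Finset.sum_congr rfl fun β hβ => ?_
    have hi := (Finset.mem_filter.1 hβ).2
    rw [sum_cofactor_mul β hM i hi i hi, if_pos rfl]
  · rw [Matrix.one_apply_ne hij, smul_zero, zero_sub]
    set f : Finset ι → ℍ[ℝ] := fun γ => if i ∈ γ then -∑ z ∈ γ, cofactor M γ i z * M z j else 0
      with hf
    have hl : adjCoeff M (s + 1) i j =
        ∑ β ∈ ((Finset.univ : Finset ι).powersetCard (s + 1)).filter (j ∈ ·), f (β.erase j) := by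
      simp only [adjCoeff, Matrix.of_apply, Finset.sum_filter, hf]
      refine Finset.sum_congr rfl fun β _ => ?_
      by_cases hi : i ∈ β
      · by_cases hj : j ∈ β
        · rw [if_pos hi, if_pos hj, if_pos (Finset.mem_erase.2 ⟨hij, hi⟩),
            (cofactorRules hM β).right_rec i hi j hj hij]
        · rw [if_pos hi, if_neg hj, cofactor_of_notMem hM hi hj]
      · rw [if_neg hi, if_neg (fun h => hi (Finset.mem_of_mem_erase h)), ite_self]
    rw [hl, sum_powersetCard_erase s j f, hf, ← Finset.sum_neg_distrib, Finset.sum_filter,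
      Finset.sum_filter]
    refine Finset.sum_congr rfl fun γ _ => ?_
    by_cases hi : i ∈ γ
    · by_cases hj : j ∈ γ
      · rw [if_neg (not_not.2 hj), if_pos hi, sum_cofactor_mul γ hM i hi j hj, if_neg hij, neg_zero]
      · rw [if_pos hj, if_pos hi]
    · simp only [if_neg hi, ite_self]

theorem minorSum_zero (M : Matrix ι ι ℍ[ℝ]) : minorSum M 0 = 1 := by
  simp [minorSum, minor_empty]

theorem minorSum_of_card_lt (M : Matrix ι ι ℍ[ℝ]) {s : ℕ} (hs : Fintype.card ι < s) :
    minorSum M s = 0 := by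
  rw [minorSum, Finset.powersetCard_eq_empty.2 (by simpa using hs)]
  simp

theorem adjCoeff_of_card_lt (M : Matrix ι ι ℍ[ℝ]) {s : ℕ} (hs : Fintype.card ι < s) :
    adjCoeff M s = 0 := by
  ext1 i j
  simp only [adjCoeff, Matrix.of_apply]
  rw [Finset.powersetCard_eq_empty.2 (by simpa using hs)]
  simp

theorem adjCoeff_zero (M : Matrix ι ι ℍ[ℝ]) : adjCoeff M 0 = 0 := by
  ext1 i j
  simp [adjCoeff, Finset.filter_singleton]

/-- The coefficientwise form of the fact that the derivative of the characteristic polynomial is the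
trace of the adjugate. -/
theorem trace_adjCoeff_succ {M : Matrix ι ι ℍ[ℝ]} (hM : M.IsHermitian) {s : ℕ} :
    (adjCoeff M (s + 1)).trace = ((Fintype.card ι - s : ℕ) : ℍ[ℝ]) * minorSum M s := by
  rw [Matrix.trace, coe_minorSum hM, Finset.mul_sum]
  simp only [Matrix.diag_apply, adjCoeff_succ_diag hM, Finset.sum_filter]
  rw [Finset.sum_comm]
  refine Finset.sum_congr rfl fun γ hγ => ?_
  rw [← Finset.sum_filter, Finset.sum_const, nsmul_eq_mul, Finset.filter_notMem_eq_sdiff,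
    ← Finset.compl_eq_univ_sdiff, Finset.card_compl, (Finset.mem_powersetCard_univ.1 hγ)]

theorem commute_adjCoeff {M B : Matrix ι ι ℍ[ℝ]} (hM : M.IsHermitian) (hB : Commute M B) (s : ℕ) :
    Commute (adjCoeff M s) B := by
  induction s with
  | zero => rw [adjCoeff_zero]; exact Commute.zero_left _
  | succ s ih =>
    rw [adjCoeff_succ hM]
    exact ((Commute.one_left B).smul_left _).sub_left (ih.mul_left hB)

theorem mul_eq_zero_of_mul_pow_eq_zero {H Y : Matrix ι ι ℍ[ℝ]} (hH : H.IsHermitian) (m : ℕ)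
    (h : Y * H ^ m = 0) : Y * H = 0 := by
  induction m with
  | zero => rw [pow_zero, mul_one] at h; rw [h, zero_mul]
  | succ m ih =>
    rcases m with _ | m
    · simpa using h
    refine ih (eq_zero_of_self_mul_conjTranspose ?_)
    have hp : H ^ (m + 1) * H ^ (m + 1) = H ^ (m + 1 + 1) * H ^ m := by
      rw [← pow_add, ← pow_add]; congr 1; omega
    rw [Matrix.conjTranspose_mul, (hH.pow _).eq, mul_assoc, ← mul_assoc (H ^ (m + 1)), hp,
      ← mul_assoc, ← mul_assoc, h, zero_mul, zero_mul]

/-- If `s` is the largest order with a nonzero sum of principal minors, then zero is an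
`(n - s)`-fold root of the characteristic polynomial, and semisimplicity reduces the Cayley–Hamilton
identity to an identity of low degree. -/
theorem adjCoeff_succ_mul_eq_zero {H : Matrix ι ι ℍ[ℝ]} (hH : H.IsHermitian) {s : ℕ}
    (hs : ∀ m, s < m → minorSum H m = 0) : adjCoeff H (s + 1) * H = 0 := by
  have hp : ∀ m, adjCoeff H (s + 1 + m) = adjCoeff H (s + 1) * (-H) ^ m := by
    intro m
    induction m with
    | zero => simp
    | succ m ih =>
      rw [← add_assoc, adjCoeff_succ hH, hs _ (by omega), ih, zero_smul, zero_sub, pow_succ,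
        ← mul_assoc, mul_neg]
  have h := hp (Fintype.card ι)
  rw [adjCoeff_of_card_lt H (by omega)] at h
  have h2 := mul_eq_zero_of_mul_pow_eq_zero hH.neg _ h.symm
  rwa [mul_neg, neg_eq_zero] at h2

end CharPoly

/-! ### The rank of a quaternion matrix -/

section Rank
variable {n : ℕ}

/-- Column spaces are right vector spaces: the coefficients of a combination of columns stand on the
right of the entries, as in `A.mulVec w`. -/
theorem mem_span_col_iff {κ : Type*} [Fintype κ] (A : Matrix (Fin n) κ ℍ[ℝ]) (v : Fin n → ℍ[ℝ]) :
    v ∈ Submodule.span ℍ[ℝ]ᵐᵒᵖ (Set.range fun j => A.col j) ↔ ∃ w, v = A.mulVec w := by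
  rw [Submodule.mem_span_range_iff_exists_fun]
  constructor
  · rintro ⟨c, rfl⟩
    refine ⟨fun j => (c j).unop, ?_⟩
    ext1 x
    simp [Matrix.mulVec, dotProduct, Finset.sum_apply, MulOpposite.smul_eq_mul_unop]
  · rintro ⟨w, rfl⟩
    refine ⟨fun j => MulOpposite.op (w j), ?_⟩
    ext1 x
    simp [Matrix.mulVec, dotProduct, Finset.sum_apply, MulOpposite.smul_eq_mul_unop]

theorem exists_mul_of_forall_col_mem {κ μ : Type*} [Fintype κ] {A : Matrix (Fin n) κ ℍ[ℝ]}
    {B : Matrix (Fin n) μ ℍ[ℝ]}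
    (h : ∀ j, B.col j ∈ Submodule.span ℍ[ℝ]ᵐᵒᵖ (Set.range fun j => A.col j)) :
    ∃ Y : Matrix κ μ ℍ[ℝ], B = A * Y := by
  choose w hw using fun j => (mem_span_col_iff A _).1 (h j)
  refine ⟨Matrix.of fun x j => w j x, ?_⟩
  ext1 x j
  exact congrFun (hw j) x

theorem span_col_mul_le (A B : Matrix (Fin n) (Fin n) ℍ[ℝ]) :
    Submodule.span ℍ[ℝ]ᵐᵒᵖ (Set.range fun j => (A * B).col j) ≤
      Submodule.span ℍ[ℝ]ᵐᵒᵖ (Set.range fun j => A.col j) := by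
  rw [Submodule.span_le]
  rintro _ ⟨j, rfl⟩
  exact (mem_span_col_iff A _).2 ⟨B.col j, rfl⟩

theorem exists_eq_mul_of_qrank_eq {A B : Matrix (Fin n) (Fin n) ℍ[ℝ]}
    (h : qrank (A * B) = qrank A) : ∃ Y : Matrix (Fin n) (Fin n) ℍ[ℝ], A = A * B * Y := by
  have := FiniteDimensional.span_of_finite ℍ[ℝ]ᵐᵒᵖ (Set.finite_range fun j : Fin n => A.col j)
  have := Submodule.eq_of_le_of_finrank_eq (span_col_mul_le A B) h
  refine exists_mul_of_forall_col_mem fun j => ?_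
  rw [this]
  exact Submodule.subset_span ⟨j, rfl⟩

/-- Over the quaternions only the real part of the trace is invariant under cyclic permutation. -/
theorem re_trace_mul_comm {κ μ : Type*} [Fintype κ] [Fintype μ] (U : Matrix κ μ ℍ[ℝ])
    (V : Matrix μ κ ℍ[ℝ]) : (U * V).trace.re = (V * U).trace.re := by
  simp only [Matrix.trace, Matrix.diag_apply, Matrix.mul_apply, re_sum]
  rw [Finset.sum_comm]
  refine Finset.sum_congr rfl fun x _ => Finset.sum_congr rfl fun y _ => ?_
  rw [Quaternion.re_mul, Quaternion.re_mul]
  ring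

/-- The real part of the trace of a projection onto the column space of `H` is the rank of `H`. -/
theorem re_trace_eq_qrank {H Q : Matrix (Fin n) (Fin n) ℍ[ℝ]} (h : H * Q * H = H) :
    (H * Q).trace.re = qrank H := by
  set W := Submodule.span ℍ[ℝ]ᵐᵒᵖ (Set.range fun j : Fin n => H.col j)
  have : FiniteDimensional ℍ[ℝ]ᵐᵒᵖ W :=
    FiniteDimensional.span_of_finite ℍ[ℝ]ᵐᵒᵖ (Set.finite_range fun j : Fin n => H.col j)
  -- a basis of the column space gives a rank factorization `H = U * V` with `V * Q * U = 1`
  let u := Module.finBasis ℍ[ℝ]ᵐᵒᵖ W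
  let U : Matrix (Fin n) (Fin (Module.finrank ℍ[ℝ]ᵐᵒᵖ W)) ℍ[ℝ] :=
    Matrix.of fun x a => (u a : Fin n → ℍ[ℝ]) x
  have hspan : Submodule.span ℍ[ℝ]ᵐᵒᵖ (Set.range fun a => U.col a) = W := by
    have := congrArg (Submodule.map W.subtype) u.span_eq
    rw [Submodule.map_span, Submodule.map_top, Submodule.range_subtype, ← Set.range_comp] at this
    exact this
  obtain ⟨V, hV⟩ : ∃ V, H = U * V := exists_mul_of_forall_col_mem fun j => by
    rw [hspan]; exact Submodule.subset_span ⟨j, rfl⟩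
  obtain ⟨B, hB⟩ : ∃ B, U = H * B := exists_mul_of_forall_col_mem fun a => (u a).2
  have hinj : ∀ w, U.mulVec w = 0 → w = 0 := by
    intro w hw
    have hli := Fintype.linearIndependent_iff.1 u.linearIndependent (fun a => MulOpposite.op (w a))
      (Subtype.ext (by
        ext1 x
        simpa [U, Matrix.mulVec, dotProduct, Finset.sum_apply, MulOpposite.smul_eq_mul_unop]
          using congrFun hw x))
    ext1 a
    exact MulOpposite.op_injective (hli a)
  have h1 : V * Q * U = 1 := by
    have h2 : U * (V * Q * U) = U := by
      rw [← Matrix.mul_assoc, ← Matrix.mul_assoc, ← hV]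
      conv_rhs => rw [hB, ← h, Matrix.mul_assoc, ← hB]
    ext1 a c
    have h3 := hinj (fun x => (V * Q * U) x c - (1 : Matrix _ _ ℍ[ℝ]) x c) (by
      ext1 x
      have := congrFun (congrFun h2 x) c
      rw [Matrix.mul_apply] at this
      simp only [Matrix.mulVec, dotProduct, mul_sub, Finset.sum_sub_distrib, Pi.zero_apply]
      rw [this, sub_eq_zero]
      simp [Matrix.one_apply])
    exact sub_eq_zero.1 (congrFun h3 a)
  have h4 : H * Q = U * (V * Q) := by rw [← Matrix.mul_assoc, ← hV]
  rw [h4, re_trace_mul_comm, h1, Matrix.trace_one]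
  rw [Fintype.card_fin, Quaternion.re_natCast]
  rfl

/-- For a Hermitian matrix, the rank is the largest order with a nonzero sum of principal minors, and
the adjugate coefficient of that order inverts `H` on the column space of `H`, up to the scalar
`minorSum H (qrank H)`. -/
theorem minorSum_qrank_ne_zero_and_mul_mul {H : Matrix (Fin n) (Fin n) ℍ[ℝ]} (hH : H.IsHermitian) :
    minorSum H (qrank H) ≠ 0 ∧
      adjCoeff H (qrank H) * H * H = minorSum H (qrank H) • H := by
  classical
  set s := Nat.findGreatest (fun s => minorSum H s ≠ 0) n with hs
  have hd : minorSum H s ≠ 0 :=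
    Nat.findGreatest_spec (P := fun s => minorSum H s ≠ 0) (Nat.zero_le n) (by simp [minorSum_zero])
  have hlt : ∀ m, s < m → minorSum H m = 0 := by
    intro m hm
    by_cases hmn : m ≤ n
    · exact not_not.1 (Nat.findGreatest_is_greatest hm hmn)
    · exact minorSum_of_card_lt H (by simpa using hmn)
  have hsn : s ≤ n := Nat.findGreatest_le n
  have hmul : adjCoeff H s * H * H = minorSum H s • H := by
    have h0 := adjCoeff_succ_mul_eq_zero hH hlt
    rw [adjCoeff_succ hH, sub_mul, Matrix.smul_mul, one_mul, sub_eq_zero] at h0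
    exact h0.symm
  have hcomm : Commute (adjCoeff H s) H := commute_adjCoeff hH (Commute.refl H) s
  have htr : ((H * ((minorSum H s)⁻¹ • adjCoeff H s)).trace).re = qrank H := by
    refine re_trace_eq_qrank ?_
    rw [Matrix.mul_smul, Matrix.smul_mul, ← hcomm.eq, hmul, smul_smul, inv_mul_cancel₀ hd, one_smul]
  have htr2 : ((adjCoeff H s * H).trace).re = s * minorSum H s := by
    have e : adjCoeff H s * H = minorSum H s • 1 - adjCoeff H (s + 1) := by
      rw [adjCoeff_succ hH, sub_sub_cancel]
    rw [e, Matrix.trace_sub, Matrix.trace_smul, trace_adjCoeff_succ hH, Matrix.trace_one,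
      Fintype.card_fin, Quaternion.re_sub, Quaternion.re_smul, Nat.cast_sub hsn]
    simp
    ring
  have hsr : s = qrank H := by
    rw [Matrix.mul_smul, Matrix.trace_smul, ← hcomm.eq, Quaternion.re_smul, htr2, smul_eq_mul, mul_comm,
      mul_assoc, mul_inv_cancel₀ hd, mul_one] at htr
    exact_mod_cast htr
  rw [← hsr]
  exact ⟨hd, hmul⟩

end Rank

/-! ### Drazin inverses -/

section DrazinInverse
variable {n : ℕ}

/-- The matrix form of the Drazin–Cramer formula: the entries of `adjCoeff M s * B` are sums of
column determinants of principal submatrices. -/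
theorem adjCoeff_mul_apply {ι : Type*} [Fintype ι] [LinearOrder ι] {M : Matrix ι ι ℍ[ℝ]}
    (hM : M.IsHermitian) (s : ℕ) (B : Matrix ι ι ℍ[ℝ]) (i j : ι) :
    (adjCoeff M s * B) i j = ∑ β : {β : Finset ι // β.card = s ∧ i ∈ β},
      cdet (⟨i, β.2.2⟩ : β.1) (principal (M.updateCol i (B.col j)) β.1) := by
  simp only [cdet_principal_updateCol]
  rw [← Finset.sum_subtype (((Finset.univ : Finset ι).powersetCard s).filter (i ∈ ·))
    (fun β => by simp) (fun β => colExp M β i 1 (B.col j))]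
  simp only [Matrix.mul_apply, adjCoeff, Matrix.of_apply, Finset.sum_mul]
  rw [Finset.sum_comm]
  refine Finset.sum_congr rfl fun β hβ => ?_
  have hi := (Finset.mem_filter.1 hβ).2
  rw [(cofactorRules hM β).colExp_eq_sum i hi, one_mul]
  refine (Finset.sum_subset (Finset.subset_univ β) ?_).symm
  intro l _ hl
  rw [cofactor_of_notMem hM hi hl, zero_mul]

theorem sum_hdet_principal {ι : Type*} [Fintype ι] [LinearOrder ι] {M : Matrix ι ι ℍ[ℝ]}
    (hM : M.IsHermitian) (s : ℕ) :
    ∑ β ∈ (Finset.univ : Finset ι).powersetCard s, hdet (principal M β) = minorSum M s := by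
  rw [coe_minorSum hM]
  refine Finset.sum_congr rfl fun β _ => ?_
  rw [hdet_principal, hM.eq, (cofactorRules hM β).star_minor]

theorem IsDrazinInverse.pow_mul_pow {A X : Matrix (Fin n) (Fin n) ℍ[ℝ]} (h : IsDrazinInverse A X)
    (m : ℕ) : X = X ^ (m + 1) * A ^ m := by
  have hc : Commute X A := h.comm.symm
  induction m with
  | zero => simp
  | succ m ih =>
    have e : X ^ (m + 1 + 1) * A ^ (m + 1) = X * (X ^ (m + 1) * A ^ m) * A := by
      rw [pow_succ' X (m + 1), pow_succ A m, mul_assoc, mul_assoc, mul_assoc]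
    rw [e, ← ih, mul_assoc, hc.eq, ← mul_assoc, h.mul_mul]

theorem IsDrazinInverse.unique {A X Y : Matrix (Fin n) (Fin n) ℍ[ℝ]} (hX : IsDrazinInverse A X)
    (hY : IsDrazinInverse A Y) : X = Y := by
  have hcX : Commute X A := hX.comm.symm
  have hcY : Commute Y A := hY.comm.symm
  have e1 : X = X * A * Y := by
    conv_lhs => rw [hX.pow_mul_pow (index A), ← hY.pow_mul, ← mul_assoc]
    rw [pow_succ A, ← mul_assoc, ← hX.pow_mul_pow (index A)]
  have e2 : Y = X * A * Y := by
    conv_lhs => rw [hY.pow_mul_pow (index A), ((hcY.pow_pow _ _).eq), ← hX.pow_mul,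
      ← (hcX.pow_right _).eq, pow_succ' A, mul_assoc, mul_assoc, ← (hcY.pow_pow _ _).eq,
      ← hY.pow_mul_pow (index A)]
    rw [mul_assoc]
  rw [e2]; exact e1

theorem IsDrazinInverse.conjTranspose {A X : Matrix (Fin n) (Fin n) ℍ[ℝ]} (hA : A.IsHermitian)
    (h : IsDrazinInverse A X) : IsDrazinInverse A X.conjTranspose := by
  have hc : Commute A X := h.comm
  refine ⟨?_, ?_, ?_⟩
  · have := congrArg Matrix.conjTranspose h.pow_mul
    rwa [(hc.pow_left _).eq, Matrix.conjTranspose_mul, (hA.pow _).eq, (hA.pow _).eq] at this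
  · have := congrArg Matrix.conjTranspose h.mul_mul
    rwa [Matrix.conjTranspose_mul, Matrix.conjTranspose_mul, hA.eq, ← mul_assoc] at this
  · have := congrArg Matrix.conjTranspose h.comm
    rw [Matrix.conjTranspose_mul, Matrix.conjTranspose_mul, hA.eq] at this
    exact this.symm

theorem isDrazinInverse_adjCoeff {A : Matrix (Fin n) (Fin n) ℍ[ℝ]} (hA : A.IsHermitian)
    (h : qrank (A ^ (index A + 1)) = qrank (A ^ index A)) :
    IsDrazinInverse A ((minorSum (A ^ (index A + 1)) (qrank (A ^ (index A + 1))))⁻¹ •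
      (adjCoeff (A ^ (index A + 1)) (qrank (A ^ (index A + 1))) * A ^ index A)) := by
  set k := index A with hk
  set H := A ^ (k + 1) with hH
  have hHh : H.IsHermitian := hA.pow _
  obtain ⟨hd, hmul⟩ := minorSum_qrank_ne_zero_and_mul_mul hHh
  have hHA : Commute H A := (Commute.refl A).pow_left _
  have hCA : Commute (adjCoeff H (qrank H)) A := commute_adjCoeff hHh hHA _
  set C := adjCoeff H (qrank H)
  set d := minorSum H (qrank H)
  obtain ⟨B, hB⟩ : ∃ B : Matrix (Fin n) (Fin n) ℍ[ℝ], A ^ k = H * B := by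
    rw [hH, pow_succ] at h ⊢
    exact exists_eq_mul_of_qrank_eq h
  -- `d⁻¹ • C` inverts `H` on the column space of `A ^ k`
  have hinv : C * H * A ^ k = d • A ^ k := by
    rw [hB, ← mul_assoc, hmul, Matrix.smul_mul]
  have hHC : H * (C * A ^ k) = d • A ^ k := by
    rw [← mul_assoc, ← (commute_adjCoeff hHh (Commute.refl H) _).eq, hinv]
  refine ⟨?_, ?_, ?_⟩
  · rw [← hk, Matrix.mul_smul, ← hH, hHC, smul_smul, inv_mul_cancel₀ hd, one_smul]
  · have e : C * A ^ k * A * (C * A ^ k) = d • (C * A ^ k) := by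
      rw [mul_assoc C, ← pow_succ, ← hH, mul_assoc, hHC, Matrix.mul_smul]
    rw [Matrix.smul_mul, Matrix.mul_smul, Matrix.smul_mul, e, smul_smul d⁻¹ d,
      inv_mul_cancel₀ hd, one_smul]
  · rw [Matrix.mul_smul, Matrix.smul_mul, ← mul_assoc, ← hCA.eq, mul_assoc, mul_assoc, ← pow_succ,
      ← pow_succ']

theorem conjTranspose_principal_updateCol {ι : Type*} [LinearOrder ι] {M : Matrix ι ι ℍ[ℝ]}
    (hM : M.IsHermitian) {B : Matrix ι ι ℍ[ℝ]} (hB : B.IsHermitian) (i j : ι) (β : Finset ι) :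
    (principal (M.updateRow j (B.row i)) β).conjTranspose =
      principal (M.updateCol j (B.col i)) β := by
  ext1 x y
  simp only [principal, Matrix.conjTranspose_apply, Matrix.submatrix_apply, Matrix.updateRow_apply,
    Matrix.updateCol_apply, Matrix.row_apply, Matrix.col_apply]
  split_ifs
  · exact hB.apply _ _
  · exact hM.apply _ _

end DrazinInverse

end QuatDrazin

end

theorem theorem3p2 (n k r : ℕ) (A : Matrix (Fin n) (Fin n) ℍ[ℝ]) (hA : A.IsHermitian)
    (hk : QuatDrazin.index A = k)
    (hr : QuatDrazin.qrank (A ^ (k + 1)) = r) (hr' : QuatDrazin.qrank (A ^ k) = r) :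
    (∃! D : Matrix (Fin n) (Fin n) ℍ[ℝ], QuatDrazin.IsDrazinInverse A D) ∧
    (∑ β ∈ (Finset.univ : Finset (Fin n)).powersetCard r,
      QuatDrazin.hdet (QuatDrazin.principal (A ^ (k + 1)) β)) ≠ 0 ∧
    ∀ D : Matrix (Fin n) (Fin n) ℍ[ℝ], QuatDrazin.IsDrazinInverse A D →
      ∀ i j : Fin n,
        D i j =
          (∑ β : {β : Finset (Fin n) // β.card = r ∧ i ∈ β},
            QuatDrazin.cdet (⟨i, β.2.2⟩ : β.1)
              (QuatDrazin.principal ((A ^ (k + 1)).updateCol i ((A ^ k).col j)) β.1)) /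
          (∑ β ∈ (Finset.univ : Finset (Fin n)).powersetCard r,
            QuatDrazin.hdet (QuatDrazin.principal (A ^ (k + 1)) β)) ∧
        D i j =
          (∑ α : {α : Finset (Fin n) // α.card = r ∧ j ∈ α},
            QuatDrazin.rdet (⟨j, α.2.2⟩ : α.1)
              (QuatDrazin.principal ((A ^ (k + 1)).updateRow j ((A ^ k).row i)) α.1)) /
          (∑ α ∈ (Finset.univ : Finset (Fin n)).powersetCard r,
            QuatDrazin.hdet (QuatDrazin.principal (A ^ (k + 1)) α)) := by
  open QuatDrazin in
  subst hk hr
  have hH : (A ^ (index A + 1)).IsHermitian := hA.pow _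
  have hdraz := isDrazinInverse_adjCoeff hA hr'.symm
  obtain ⟨hd, -⟩ := minorSum_qrank_ne_zero_and_mul_mul hH
  set C := adjCoeff (A ^ (index A + 1)) (qrank (A ^ (index A + 1)))
  set d := minorSum (A ^ (index A + 1)) (qrank (A ^ (index A + 1))) with hd_def
  have hcol : ∀ D, IsDrazinInverse A D → ∀ i j, D i j = (C * A ^ index A) i j / (d : ℍ[ℝ]) := by
    intro D hD i j
    rw [hD.unique hdraz, Matrix.smul_apply, ← Quaternion.coe_mul_eq_smul, Quaternion.coe_commutes,
      Quaternion.coe_inv, div_eq_mul_inv]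
  rw [sum_hdet_principal hH, ← hd_def]
  refine ⟨⟨_, hdraz, fun Y hY => hY.unique hdraz⟩, fun h => hd ?_, fun D hD i j => ⟨?_, ?_⟩⟩
  · rw [← Quaternion.coe_zero] at h
    exact Quaternion.coe_injective h
  · rw [hcol D hD, adjCoeff_mul_apply hH]
  · -- `D` is Hermitian, so the row formula is the star of the column formula at `(j, i)`
    have hDh : D.conjTranspose = D := (hD.conjTranspose hA).unique hD
    have hDs : D i j = star (D j i) := (congrFun (congrFun hDh i) j).symm
    rw [hDs, hcol D hD, adjCoeff_mul_apply hH, div_eq_mul_inv, div_eq_mul_inv,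
      ← Quaternion.coe_inv, star_mul, Quaternion.star_coe, Quaternion.coe_commutes, star_sum]
    congr 1
    refine Finset.sum_congr rfl fun α _ => ?_
    rw [rdet_eq_star_cdet, conjTranspose_principal_updateCol hH (hA.pow _)]
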